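/- **Setting.** In the Evans unrelated-confounders (UC) scenario three observed bits $A,B,C$ and two independent latent sources $\gamma,\alpha$ are connected by $B\to A$, $B\to C$, $\gamma\to A$, $\gamma\to B$, $\alpha\to B$, $\alpha\to C$. A classical model consists of independent random latent variables $\gamma,\alpha$ (with values in arbitrary measurable spaces) and response probabilities $p_A(a|b,\gamma)$, $p_B(b|\gamma,\alpha)$, $p_C(c|b,\alpha)$. It yields $P_{ABC}(a,b,c)=\mathbb E[p_A(a|b,\gamma)p_B(b|\gamma,\alpha)p_C(c|b,\alpha)]$ and, on the interrupted graph where $A$ and $C$ respond to an exogenous value $s$ of $B^{\#}$, $Q_{ABC|B^\#}(a,b,c|s)=\mathbb E[p_A(a|s,\gamma)p_B(b|\gamma,\alpha)p_C(c|s,\alpha)]$; the interventional tables $P_A(a|do(B=s))$, $P_C(c|do(B=s))$, $P_{AC}(a,c|do(B=s))$ are the marginals of $Q(\cdot|s)$. In a quantum strategy, $\gamma$ and $\alpha$ are density matrices $\psi_{AB},\psi_{BC}$, the responses are POVMs $E_{a|b},E_b,E_{c|b}$, and $P_{ABC}(a,b,c)=\mathrm{Tr}[(\psi_{AB}\otimes\psi_{BC})(E_{a|b}\otimes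 E_b\otimes E_{c|b})]$, $P_A(a|do(B=b))=\mathrm{Tr}[\psi_{AB}(E_{a|b}\otimes 1)]$, $P_C(c|do(B=b))=\mathrm{Tr}[\psi_{BC}(1\otimes E_{c|b})]$. **Theorem.** For $0\le v\le 1$ consider the following strategy. $A$ and $B$ share the Werner state $v|\phi^+\rangle\langle\phi^+|+(1-v)\frac{1}{4}\mathbb 1$ with $|\phi^+\rangle=\frac1{\sqrt2}(|00\rangle+|11\rangle)$; $\alpha$ is a uniform classical bit sent to $B$ and $C$; $C$ outputs $c=\alpha$; $B$ measures $\frac1{\sqrt2}(\sigma_x+(-1)^\alpha\sigma_z)$ and outputs $b$; $A$ measures $\sigma_x$ if $b=0$ and $\sigma_z$ if $b=1$ (outcome $k\in\{0,1\}$ stands for the eigenvalue $(-1)^k$). 1. This is a valid quantum strategy, and $$P^v_{ABC}(a,b,c)=\tfrac18\Big[1+\tfrac{v}{\sqrt2}(-1)^{a+b+cb}\Big],\qquad P_A(a|do(B=b))=P_C(c|do(B=b))=\tfrac12 .$$ 2. For every $\frac1{\sqrt2}<v\le1$ these data tables exhibit non-classicality from data fusion. Each of $P^v_{ABC}$, $P_{A|do(B)}$,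 $P_{C|do(B)}$, and also $P_{AC|do(B)}=P_{A|do(B)}P_{C|do(B)}$, is separately reproduced by a classical model, even one with finitely many values of the latent variables. But there is no classical model whose distribution $Q$ on the interrupted graph satisfies simultaneously $Q(a,b,c|b)=P^v_{ABC}(a,b,c)$, $Q_{A|B^\#}(a|s)=P_A(a|do(B=s))$ and $Q_{C|B^\#}(c|s)=P_C(c|do(B=s))$. 3. Put $$I=2P_{AB}(0,0)+P_B(1)+P_{BC}(1,0)+P_{ABC}(0,1,1)-2P_{ABC}(0,1,0),$$ $$J=P_{AB}(0,0)-2P_{AB}(1,0)-2P_{ABC}(0,1,0),$$ $$E=2P_{AB}(0,1)P_{BC}(1,0)+P_{AB}(0,0)P_{AB}(1,0)-P_{ABC}(0,1,0)^2+\big(P_{AB}(1,0)+P_B(0)\big)\big(P_{BC}(1,0)+P_{ABC}(0,1,1)\big),$$ $$\beta=P_A(0|do(B=0))^2-P_A(0|do(B=0))\,I+E+J .$$ Then $\beta\le0$ for every classical model. More generally, $\beta\le0$ (with $P_{ABC}(a,b,c)=Q(a,b,c|b)$ and $P_A(a|do(B=s))=Q_{A|B^\#}(a|s)$) for every conditional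 distribution $Q_{ABC|B^\#}$ that admits a second-order inflation, i.e. a probability distribution $q$ of bits $A^i_s,B^{ij},C^j_s$ ($i,j,s\in\{0,1\}$), invariant under exchanging the two values of the copy index $i$ and under exchanging the two values of the copy index $j$, with $q(A^0_{s_0}=a_0,A^1_{s_1}=a_1,B^{00}=b_0,B^{11}=b_1,C^0_{s_0}=c_0,C^1_{s_1}=c_1)=Q(a_0,b_0,c_0|s_0)\,Q(a_1,b_1,c_1|s_1)$ for all values. For the strategy above with $v=1$, $\beta=\frac1{128}(38\sqrt2-53)>0$. -/

import Mathlib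

open MeasureTheory
open scoped Kronecker ComplexOrder

universe u w

noncomputable section

namespace UC

/-! All observed variables `A`, `B`, `C` are bits.  The causal structure has the observed edges
`B → A`, `B → C`, a latent source `γ` feeding `A` and `B`, and an independent latent source `α`
feeding `B` and `C`. -/

/-- Observational table: `P a b c = P_{ABC}(a, b, c)`. -/
abbrev ObsTable := Fin 2 → Fin 2 → Fin 2 → ℝ

/-- Interventional table of one variable: `T x b = P_X(x | do(B = b))`. -/
abbrev DoTable := Fin 2 → Fin 2 → ℝ

/-- Table on the interrupted graph: `Q a b c s = Q_{ABC|B#}(a, b, c | s)`. -/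
abbrev SwigTable := Fin 2 → Fin 2 → Fin 2 → Fin 2 → ℝ

/-! ### Classical models -/

/-- A classical causal model: two independent latent variables `γ`, `α` with values in arbitrary
measurable spaces, and stochastic response functions for the observed nodes. -/
structure ClassicalModel (Γ : Type u) (Λ : Type w) [MeasurableSpace Γ] [MeasurableSpace Λ] where
  /-- law of `γ` -/
  μ : ProbabilityMeasure Γ
  /-- law of `α` -/
  ν : ProbabilityMeasure Λ
  /-- `pA b γ a` is `p_A(a | b, γ)` -/
  pA : Fin 2 → Γ → Fin 2 → ℝ
  /-- `pB γ α b` is `p_B(b | γ, α)` -/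
  pB : Γ → Λ → Fin 2 → ℝ
  /-- `pC b α c` is `p_C(c | b, α)` -/
  pC : Fin 2 → Λ → Fin 2 → ℝ
  measurable_pA : ∀ b a, Measurable fun γ => pA b γ a
  measurable_pB : ∀ b, Measurable fun x : Γ × Λ => pB x.1 x.2 b
  measurable_pC : ∀ b c, Measurable fun α => pC b α c
  pA_nonneg : ∀ b γ a, 0 ≤ pA b γ a
  pB_nonneg : ∀ γ α b, 0 ≤ pB γ α b
  pC_nonneg : ∀ b α c, 0 ≤ pC b α c
  pA_sum : ∀ b γ, ∑ a, pA b γ a = 1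
  pB_sum : ∀ γ α, ∑ b, pB γ α b = 1
  pC_sum : ∀ b α, ∑ c, pC b α c = 1

section Model

variable {Γ : Type u} {Λ : Type w} [MeasurableSpace Γ] [MeasurableSpace Λ]

/-- The observational distribution of a classical model. -/
def ClassicalModel.obs (M : ClassicalModel Γ Λ) : ObsTable := fun a b c =>
  ∫ γ, ∫ α, M.pA b γ a * M.pB γ α b * M.pC b α c ∂(M.ν : Measure Λ) ∂(M.μ : Measure Γ)

/-- The distribution of a classical model on the interrupted graph, where `A` and `C` react to
the exogenous value `s` of `B#` in place of `b`. -/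
def ClassicalModel.swig (M : ClassicalModel Γ Λ) : SwigTable := fun a b c s =>
  ∫ γ, ∫ α, M.pA s γ a * M.pB γ α b * M.pC s α c ∂(M.ν : Measure Λ) ∂(M.μ : Measure Γ)

end Model

/-- Observational part of a table on the interrupted graph (`B# = B`). -/
def SwigTable.obs (Q : SwigTable) : ObsTable := fun a b c => Q a b c b

/-- The marginal of `A` and `C` given `B#`. -/
def SwigTable.doAC (Q : SwigTable) (a c s : Fin 2) : ℝ := ∑ b, Q a b c s

/-- The marginal of `A` given `B#`. -/
def SwigTable.doA (Q : SwigTable) : DoTable := fun a s => ∑ b, ∑ c, Q a b c s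

/-- The marginal of `C` given `B#`. -/
def SwigTable.doC (Q : SwigTable) : DoTable := fun c s => ∑ a, ∑ b, Q a b c s

/-- For each value of `B#`, `Q` is a probability distribution of `(A, B, C)`. -/
def SwigTable.IsCondDist (Q : SwigTable) : Prop :=
  (∀ a b c s, 0 ≤ Q a b c s) ∧ ∀ s, ∑ a, ∑ b, ∑ c, Q a b c s = 1

/-- `Q` arises from a classical model on the interrupted graph, with arbitrary latent spaces. -/
def SwigTable.IsClassical (Q : SwigTable) : Prop :=
  ∃ (Γ : Type u) (Λ : Type w) (_ : MeasurableSpace Γ) (_ : MeasurableSpace Λ)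
    (M : ClassicalModel Γ Λ), Q = M.swig

/-- The tables are non-classical from data fusion: individually they have classical models (even
with finite latent variables), but no classical model on the interrupted graph, with whatever
latent spaces, is consistent with all of them. -/
structure NonClassicalFusion (P : ObsTable) (TA TC : DoTable) : Prop where
  obs_classical : ∃ (m n : ℕ) (M : ClassicalModel (Fin m) (Fin n)), M.obs = P
  doA_classical : ∃ (m n : ℕ) (M : ClassicalModel (Fin m) (Fin n)), M.swig.doA = TA
  doC_classical : ∃ (m n : ℕ) (M : ClassicalModel (Fin m) (Fin n)), M.swig.doC = TC
  /-- The joint interventional table `P_{AC|do(B)} = P_{A|do(B)} P_{C|do(B)}` is classical too. -/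
  doAC_classical : ∃ (m n : ℕ) (M : ClassicalModel (Fin m) (Fin n)),
    ∀ a c s, M.swig.doAC a c s = TA a s * TC c s
  joint_nonclassical : ¬ ∃ Q : SwigTable,
    SwigTable.IsClassical.{u, w} Q ∧ Q.obs = P ∧ Q.doA = TA ∧ Q.doC = TC

/-! ### Quantum strategies -/

/-- The data of a quantum strategy: the source `γ` sends systems `X`, `Y` to `A`, `B`, the source
`α` sends systems `Z`, `W` to `B`, `C`; all dimensions are finite. -/
structure QuantumStrategy (X Y Z W : Type) where
  ψAB : Matrix (X × Y) (X × Y) ℂ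
  ψBC : Matrix (Z × W) (Z × W) ℂ
  /-- `EA b a` is the effect `E_{a|b}` -/
  EA : Fin 2 → Fin 2 → Matrix X X ℂ
  EB : Fin 2 → Matrix (Y × Z) (Y × Z) ℂ
  /-- `EC b c` is the effect `E_{c|b}` -/
  EC : Fin 2 → Fin 2 → Matrix W W ℂ

namespace QuantumStrategy

variable {X Y Z W : Type} [Fintype X] [Fintype Y] [Fintype Z] [Fintype W]
  [DecidableEq X] [DecidableEq Y] [DecidableEq Z] [DecidableEq W]

/-- The sources are density matrices and the measurements are POVMs. -/
structure IsValid (S : QuantumStrategy X Y Z W) : Prop where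
  ψAB_psd : S.ψAB.PosSemidef
  ψAB_trace : S.ψAB.trace = 1
  ψBC_psd : S.ψBC.PosSemidef
  ψBC_trace : S.ψBC.trace = 1
  EA_psd : ∀ b a, (S.EA b a).PosSemidef
  EA_sum : ∀ b, ∑ a, S.EA b a = 1
  EB_psd : ∀ b, (S.EB b).PosSemidef
  EB_sum : ∑ b, S.EB b = 1
  EC_psd : ∀ b c, (S.EC b c).PosSemidef
  EC_sum : ∀ b, ∑ c, S.EC b c = 1

/-- Born rule `Tr((ψ_AB ⊗ ψ_BC)(E_{a|b} ⊗ E_b ⊗ E_{c|b}))`; the `submatrix` only rebrackets the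
tensor factors. -/
def obs (S : QuantumStrategy X Y Z W) : ObsTable := fun a b c =>
  (((S.ψAB ⊗ₖ S.ψBC) *
    (S.EA b a ⊗ₖ (S.EB b ⊗ₖ S.EC b c)).submatrix
      (fun p : (X × Y) × (Z × W) => (p.1.1, ((p.1.2, p.2.1), p.2.2)))
      (fun p : (X × Y) × (Z × W) => (p.1.1, ((p.1.2, p.2.1), p.2.2)))).trace).re

/-- `P_A(a | do(B = b)) = Tr(ψ_AB (E_{a|b} ⊗ 1))`. -/
def doA (S : QuantumStrategy X Y Z W) : DoTable := fun a b =>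
  ((S.ψAB * (S.EA b a ⊗ₖ (1 : Matrix Y Y ℂ))).trace).re

/-- `P_C(c | do(B = b)) = Tr(ψ_BC (1 ⊗ E_{c|b}))`. -/
def doC (S : QuantumStrategy X Y Z W) : DoTable := fun c b =>
  ((S.ψBC * ((1 : Matrix Z Z ℂ) ⊗ₖ S.EC b c)).trace).re

end QuantumStrategy

/-- Pauli matrix `σ_x`. -/
def σx : Matrix (Fin 2) (Fin 2) ℂ := !![0, 1; 1, 0]

/-- Pauli matrix `σ_z`. -/
def σz : Matrix (Fin 2) (Fin 2) ℂ := !![1, 0; 0, -1]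

/-- The vector `(|00⟩ + |11⟩)/√2`. -/
def phiPlus : Fin 2 × Fin 2 → ℂ := fun p => if p.1 = p.2 then ((1 / √2 : ℝ) : ℂ) else 0

/-- The Werner state of visibility `v`. -/
def werner (v : ℝ) : Matrix (Fin 2 × Fin 2) (Fin 2 × Fin 2) ℂ :=
  (v : ℂ) • Matrix.vecMulVec phiPlus (star phiPlus) + (((1 - v) / 4 : ℝ) : ℂ) • 1

/-- For an observable `O` with `O² = 1`, the projector on the eigenvalue `(-1)^k`, which is
read as outcome `k`. -/
def outcomeProj (O : Matrix (Fin 2) (Fin 2) ℂ) (k : Fin 2) : Matrix (Fin 2) (Fin 2) ℂ :=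
  (1 / 2 : ℂ) • (1 + (-1 : ℂ) ^ (k : ℕ) • O)

/-- `A` measures `σ_x` if `b = 0` and `σ_z` if `b = 1`. -/
def obsA (b : Fin 2) : Matrix (Fin 2) (Fin 2) ℂ := if b = 0 then σx else σz

/-- `B` measures `(σ_x + (-1)^α σ_z)/√2`. -/
def obsB (α : Fin 2) : Matrix (Fin 2) (Fin 2) ℂ :=
  ((1 / √2 : ℝ) : ℂ) • (σx + (-1 : ℂ) ^ (α : ℕ) • σz)

/-- `|k⟩⟨k|`. -/
def ketbra (k : Fin 2) : Matrix (Fin 2) (Fin 2) ℂ := Matrix.single k k 1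

/-- The strategy: a Werner state between `A` and `B`, a uniform classical bit `α` sent to `B` and
`C` (the state `½ ∑_α |α⟩⟨α| ⊗ |α⟩⟨α|`), which `B` reads to choose the measurement and which `C`
outputs. -/
def strategy (v : ℝ) : QuantumStrategy (Fin 2) (Fin 2) (Fin 2) (Fin 2) where
  ψAB := werner v
  ψBC := ∑ α, (1 / 2 : ℂ) • (ketbra α ⊗ₖ ketbra α)
  EA b a := outcomeProj (obsA b) a
  EB b := ∑ α, outcomeProj (obsB α) b ⊗ₖ ketbra α
  EC _ c := ketbra c

/-! ### The quadratic witness and second-order inflation -/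

/-- `P_{AB}` -/
def margAB (P : ObsTable) (a b : Fin 2) : ℝ := ∑ c, P a b c

/-- `P_{BC}` -/
def margBC (P : ObsTable) (b c : Fin 2) : ℝ := ∑ a, P a b c

/-- `P_B` -/
def margB (P : ObsTable) (b : Fin 2) : ℝ := ∑ a, ∑ c, P a b c

/-- The linear quantity that multiplies `P_A(0 | do(B = 0))` in the witness. -/
def witnessI (P : ObsTable) : ℝ :=
  2 * margAB P 0 0 + margB P 1 + margBC P 1 0 + P 0 1 1 - 2 * P 0 1 0

/-- The linear terms of the witness. -/
def witnessJ (P : ObsTable) : ℝ := margAB P 0 0 - 2 * margAB P 1 0 - 2 * P 0 1 0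

/-- The quadratic terms of the witness. -/
def witnessE (P : ObsTable) : ℝ :=
  2 * margAB P 0 1 * margBC P 1 0 + margAB P 0 0 * margAB P 1 0 - P 0 1 0 ^ 2
    + (margAB P 1 0 + margB P 0) * (margBC P 1 0 + P 0 1 1)

/-- The quadratic witness, a function of `P_{ABC}` and `P_{A|do(B)}`. -/
def witness (P : ObsTable) (TA : DoTable) : ℝ :=
  TA 0 0 ^ 2 - TA 0 0 * witnessI P + witnessE P + witnessJ P

/-- `Q` admits a second-order inflation: a distribution `q` of bits `A i s`, `B i j`, `C j s`,
where `i` and `j` index two copies of the sources `γ` and `α` and `s` is a value of `B#`, which is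
invariant under the exchange of the two copies of either source, and in which the diagonal copies
reproduce the products of two entries of `Q`. -/
def SwigTable.HasSecondOrderInflation (Q : SwigTable) : Prop :=
  ∃ q : (Fin 2 → Fin 2 → Fin 2) → (Fin 2 → Fin 2 → Fin 2) → (Fin 2 → Fin 2 → Fin 2) → ℝ,
    (∀ A B C, 0 ≤ q A B C) ∧
    (∑ A, ∑ B, ∑ C, q A B C = 1) ∧
    (∀ A B C, q (fun i => A (1 - i)) (fun i => B (1 - i)) C = q A B C) ∧
    (∀ A B C, q A (fun i j => B i (1 - j)) (fun j => C (1 - j)) = q A B C) ∧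
    (∀ s₀ s₁ a₀ a₁ b₀ b₁ c₀ c₁ : Fin 2,
      (∑ A, ∑ B, ∑ C,
        if A 0 s₀ = a₀ ∧ A 1 s₁ = a₁ ∧ B 0 0 = b₀ ∧ B 1 1 = b₁ ∧ C 0 s₀ = c₀ ∧ C 1 s₁ = c₁
        then q A B C else 0) = Q a₀ b₀ c₀ s₀ * Q a₁ b₁ c₁ s₁)

end UC

end

/-! *Data fusion.* If `C` is unbiased given `B# = 1`, it acts as a random measurement setting which
`B` knows and which is independent of `γ`, so that the correlations obey a Bell inequality.
Pointwise in the latent variables it holds up to a term `g γ * y α` with `∫ y = 0`. The strategy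
reaches `v / √2` where classical models reach at most `1 / 2`.

*Witness.* The quadratic witness is the diagonal of a bilinear form in two copies of the table `Q`.
The diagonal marginal of an inflation writes `Q ⊗ Q` as a mixture of products of two deterministic
tables. On such a pair the symmetrized form is at most a term antisymmetric under the exchange of
the two copies of `α`, whose mean vanishes by exchange symmetry. -/

noncomputable section

namespace UC

section Quantum

open Matrix

variable {n X Y Z W : Type*} [Fintype n] [DecidableEq n] [Fintype X] [Fintype Y] [Fintype Z]
  [Fintype W]

theorem posSemidef_half_smul_one_add {O : Matrix n n ℂ} (hO : O.IsHermitian)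
    (hsq : O * O = 1) : ((1 / 2 : ℂ) • (1 + O)).PosSemidef := by
  have hsymm : ((1 / 2 : ℂ) • (1 + O))ᴴ = (1 / 2 : ℂ) • (1 + O) := by
    simp [conjTranspose_smul, hO.eq]
  have hidem : (1 / 2 : ℂ) • (1 + O) = ((1 / 2 : ℂ) • (1 + O))ᴴ * ((1 / 2 : ℂ) • (1 + O)) := by
    rw [hsymm, smul_mul_smul_comm, add_mul, mul_add, mul_add, hsq, one_mul, mul_one, one_mul]
    module
  exact hidem ▸ posSemidef_conjTranspose_mul_self _

theorem outcomeProj_posSemidef {O : Matrix (Fin 2) (Fin 2) ℂ} (hO : O.IsHermitian)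
    (hsq : O * O = 1) (k : Fin 2) : (outcomeProj O k).PosSemidef := by
  refine posSemidef_half_smul_one_add (hO.smul (IsSelfAdjoint.neg (.one ℂ) |>.pow _)) ?_
  rw [smul_mul_smul_comm, hsq, ← pow_add, Even.neg_one_pow ⟨_, rfl⟩, one_smul]

theorem sum_outcomeProj (O : Matrix (Fin 2) (Fin 2) ℂ) : ∑ k, outcomeProj O k = 1 := by
  simp only [outcomeProj, Fin.sum_univ_two, Fin.val_zero, Fin.val_one, pow_zero, pow_one]
  module

theorem trace_outcomeProj {O : Matrix (Fin 2) (Fin 2) ℂ} (hO : O.trace = 0) (k : Fin 2) :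
    (outcomeProj O k).trace = 1 := by
  simp [outcomeProj, hO]

theorem σx_mul_self : σx * σx = 1 := by
  simp [σx, one_fin_two]

theorem σz_mul_self : σz * σz = 1 := by
  simp [σz, one_fin_two]

theorem σx_mul_σz_add_σz_mul_σx : σx * σz + σz * σx = 0 := by
  simp [σx, σz, ← Matrix.ext_iff]

theorem σx_isHermitian : σx.IsHermitian := by
  ext i j; fin_cases i <;> fin_cases j <;> simp [σx]

theorem σz_isHermitian : σz.IsHermitian := by
  ext i j; fin_cases i <;> fin_cases j <;> simp [σz]

theorem obsA_isHermitian (b : Fin 2) : (obsA b).IsHermitian := by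
  unfold obsA; split_ifs
  exacts [σx_isHermitian, σz_isHermitian]

theorem obsA_mul_self (b : Fin 2) : obsA b * obsA b = 1 := by
  unfold obsA; split_ifs
  exacts [σx_mul_self, σz_mul_self]

theorem obsB_isHermitian (α : Fin 2) : (obsB α).IsHermitian :=
  (σx_isHermitian.add (σz_isHermitian.smul (IsSelfAdjoint.neg (.one ℂ) |>.pow _))).smul
    (Complex.conj_ofReal _)

theorem inv_sqrt_two_mul_self : ((1 / √2 : ℝ) : ℂ) * ((1 / √2 : ℝ) : ℂ) = 1 / 2 := by
  rw [← Complex.ofReal_mul, div_mul_div_comm, Real.mul_self_sqrt (by norm_num)]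
  norm_num

theorem obsB_mul_self (α : Fin 2) : obsB α * obsB α = 1 := by
  have he : (-1 : ℂ) ^ (α : ℕ) * (-1) ^ (α : ℕ) = 1 := by
    rw [← pow_add, Even.neg_one_pow ⟨_, rfl⟩]
  calc obsB α * obsB α
      = (1 / 2 : ℂ) • (σx * σx + (-1 : ℂ) ^ (α : ℕ) • (σx * σz + σz * σx) + σz * σz) := by
        rw [obsB, smul_mul_smul_comm, inv_sqrt_two_mul_self, add_mul, mul_add, mul_add,
          smul_mul_smul_comm, he, mul_smul_comm, smul_mul_assoc]
        module
    _ = 1 := by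
        rw [σx_mul_self, σz_mul_self, σx_mul_σz_add_σz_mul_σx]
        module

theorem ketbra_posSemidef (k : Fin 2) : (ketbra k).PosSemidef := by
  have h : ketbra k = (ketbra k)ᴴ * ketbra k := by simp [ketbra]
  exact h ▸ posSemidef_conjTranspose_mul_self _

theorem sum_ketbra : ∑ k, ketbra k = 1 := by
  simp [ketbra, one_fin_two, ← Matrix.ext_iff]

theorem werner_posSemidef {v : ℝ} (h0 : 0 ≤ v) (h1 : v ≤ 1) : (werner v).PosSemidef := by
  have hnoise : 0 ≤ (1 - v) / 4 := by linarith
  exact .add (.smul (posSemidef_vecMulVec_self_star _) (by exact_mod_cast h0))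
    (.smul .one (by exact_mod_cast hnoise))

theorem phiPlus_eq_smul_vec :
    phiPlus = ((1 / √2 : ℝ) : ℂ) • vec (1 : Matrix (Fin 2) (Fin 2) ℂ) := by
  ext p
  simp [phiPlus, one_apply, eq_comm]

theorem trace_phiPlus_mul_kronecker (M N : Matrix (Fin 2) (Fin 2) ℂ) :
    (vecMulVec phiPlus (star phiPlus) * (M ⊗ₖ N)).trace = 1 / 2 * (M * Nᵀ).trace := by
  rw [trace_mul_comm, mul_vecMulVec, trace_vecMulVec, phiPlus_eq_smul_vec, star_smul, mulVec_smul,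
    smul_dotProduct, dotProduct_smul, kronecker_mulVec_vec, dotProduct_comm,
    star_vec_dotProduct_vec, smul_smul, Complex.star_def, Complex.conj_ofReal,
    inv_sqrt_two_mul_self, conjTranspose_one, one_mul, mul_one, ← trace_transpose (M * _),
    transpose_mul, transpose_transpose, smul_eq_mul]

theorem trace_werner_mul_kronecker (v : ℝ) (M N : Matrix (Fin 2) (Fin 2) ℂ) :
    (werner v * (M ⊗ₖ N)).trace =
      v / 2 * (M * Nᵀ).trace + (1 - v) / 4 * (M.trace * N.trace) := by
  simp only [werner, add_mul, smul_mul_assoc, one_mul, trace_add, trace_smul, trace_kronecker,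
    trace_phiPlus_mul_kronecker, smul_eq_mul]
  push_cast
  ring

theorem strategy_isValid {v : ℝ} (h0 : 0 ≤ v) (h1 : v ≤ 1) : (strategy v).IsValid where
  ψAB_psd := werner_posSemidef h0 h1
  ψAB_trace := by
    have h := trace_werner_mul_kronecker v 1 1
    rw [one_kronecker_one, mul_one, transpose_one, mul_one, trace_one] at h
    rw [strategy, h, Fintype.card_fin]
    ring
  ψBC_psd := posSemidef_sum _ fun α _ =>
    ((ketbra_posSemidef α).kronecker (ketbra_posSemidef α)).smul (by positivity)
  ψBC_trace := by
    norm_num [strategy, trace_kronecker, ketbra]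
  EA_psd b a := outcomeProj_posSemidef (obsA_isHermitian b) (obsA_mul_self b) a
  EA_sum b := sum_outcomeProj _
  EB_psd b := posSemidef_sum _ fun α _ =>
    (outcomeProj_posSemidef (obsB_isHermitian α) (obsB_mul_self α) b).kronecker
      (ketbra_posSemidef α)
  EB_sum := by
    have hsum (α : Fin 2) : ∑ b, outcomeProj (obsB α) b ⊗ₖ ketbra α = 1 ⊗ₖ ketbra α := by
      rw [Fin.sum_univ_two, ← add_kronecker, ← Fin.sum_univ_two (outcomeProj _), sum_outcomeProj]
    simp only [strategy]
    rw [Finset.sum_comm, Finset.sum_congr rfl fun α _ => hsum α, Fin.sum_univ_two,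
      ← kronecker_add, ← Fin.sum_univ_two ketbra, sum_ketbra, one_kronecker_one]
  EC_psd _ c := ketbra_posSemidef c
  EC_sum _ := sum_ketbra

theorem trace_obsA (b : Fin 2) : (obsA b).trace = 0 := by
  fin_cases b <;> simp [obsA, σx, σz, trace]

theorem trace_obsB (α : Fin 2) : (obsB α).trace = 0 := by
  fin_cases α <;> simp [obsB, σx, σz, trace]

theorem trace_obsA_mul_transpose_obsB (b c : Fin 2) :
    (obsA b * (obsB c)ᵀ).trace = 2 * ((1 / √2 : ℝ) : ℂ) * (-1) ^ ((c : ℕ) * (b : ℕ)) := by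
  simp only [trace_fin_two, mul_apply, Fin.sum_univ_two, transpose_apply]
  fin_cases b <;> fin_cases c <;> simp [obsA, obsB, σx, σz] <;> ring

theorem trace_werner_mul_outcomeProj_kronecker (v : ℝ) {O O' : Matrix (Fin 2) (Fin 2) ℂ}
    (hO : O.trace = 0) (hO' : O'.trace = 0) (k l : Fin 2) :
    (werner v * (outcomeProj O k ⊗ₖ outcomeProj O' l)).trace =
      1 / 4 * (1 + v * (-1) ^ ((k : ℕ) + (l : ℕ)) * ((O * O'ᵀ).trace / 2)) := by
  have hprod : (outcomeProj O k * (outcomeProj O' l)ᵀ).trace =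
      1 / 4 * (2 + (-1) ^ ((k : ℕ) + (l : ℕ)) * (O * O'ᵀ).trace) := by
    simp only [outcomeProj, transpose_smul, transpose_add, transpose_one, smul_mul_smul_comm,
      add_mul, mul_add, one_mul, mul_one, trace_smul, trace_add, trace_transpose, hO, hO',
      trace_one, Fintype.card_fin, smul_eq_mul, pow_add]
    push_cast
    ring
  rw [trace_werner_mul_kronecker, hprod, trace_outcomeProj hO, trace_outcomeProj hO']
  ring

/-- The expectation of `E ⊗ N ⊗ K` in the state `ψ ⊗ φ` of the pairs `X, Y` and `Z, W`, where `N`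
acts on the two inner systems; this is the Born rule of `QuantumStrategy.obs` as an additive
function of the effect `N` of `B`. -/
def bornTrace (ψ : Matrix (X × Y) (X × Y) ℂ) (φ : Matrix (Z × W) (Z × W) ℂ) (E : Matrix X X ℂ)
    (K : Matrix W W ℂ) : Matrix (Y × Z) (Y × Z) ℂ →+ ℂ :=
  .mk' (fun N => (ψ ⊗ₖ φ * (E ⊗ₖ (N ⊗ₖ K)).submatrix
      (fun p : (X × Y) × (Z × W) => (p.1.1, ((p.1.2, p.2.1), p.2.2)))
      (fun p : (X × Y) × (Z × W) => (p.1.1, ((p.1.2, p.2.1), p.2.2)))).trace) fun N N' => by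
    rw [add_kronecker, kronecker_add, submatrix_add, Pi.add_apply, Pi.add_apply, mul_add,
      trace_add]

theorem bornTrace_kronecker (ψ : Matrix (X × Y) (X × Y) ℂ) (φ : Matrix (Z × W) (Z × W) ℂ)
    (E : Matrix X X ℂ) (K : Matrix W W ℂ) (F : Matrix Y Y ℂ) (G : Matrix Z Z ℂ) :
    bornTrace ψ φ E K (F ⊗ₖ G) = (ψ * (E ⊗ₖ F)).trace * (φ * (G ⊗ₖ K)).trace := by
  rw [← trace_kronecker, mul_kronecker_mul]
  change trace (_ * submatrix _ _ _) = _
  congr 2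
  ext p q
  simp only [submatrix_apply, kroneckerMap_apply, mul_assoc]

theorem trace_strategy_ψBC_mul_kronecker (v : ℝ) (β c : Fin 2) :
    ((strategy v).ψBC * (ketbra β ⊗ₖ ketbra c)).trace = if β = c then 1 / 2 else 0 := by
  fin_cases β <;> fin_cases c <;>
    simp [strategy, add_mul, ← mul_kronecker_mul, trace_kronecker, ketbra]

theorem strategy_obs (v : ℝ) (a b c : Fin 2) : (strategy v).obs a b c =
    1 / 8 * (1 + v / √2 * (-1) ^ ((a : ℕ) + (b : ℕ) + (c : ℕ) * (b : ℕ))) := by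
  have hread : bornTrace (werner v) (strategy v).ψBC (outcomeProj (obsA b) a) (ketbra c)
      ((strategy v).EB b) =
        (werner v * (outcomeProj (obsA b) a ⊗ₖ outcomeProj (obsB c) b)).trace * (1 / 2) := by
    change bornTrace _ _ _ _ (∑ β, outcomeProj (obsB β) b ⊗ₖ ketbra β) = _
    simp only [map_sum, bornTrace_kronecker, trace_strategy_ψBC_mul_kronecker, mul_ite, mul_zero,
      Finset.sum_ite_eq', Finset.mem_univ, if_true]
  have hre : (werner v * (outcomeProj (obsA b) a ⊗ₖ outcomeProj (obsB c) b)).trace * (1 / 2) =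
      ((1 / 8 * (1 + v / √2 * (-1) ^ ((a : ℕ) + (b : ℕ) + (c : ℕ) * (b : ℕ))) : ℝ) : ℂ) := by
    rw [trace_werner_mul_outcomeProj_kronecker v (trace_obsA b) (trace_obsB c),
      trace_obsA_mul_transpose_obsB, pow_add _ (_ + _)]
    push_cast
    ring
  exact (congrArg Complex.re (hread.trans hre)).trans (Complex.ofReal_re _)

theorem strategy_doA (v : ℝ) (a b : Fin 2) : (strategy v).doA a b = 1 / 2 := by
  have h : (werner v * (outcomeProj (obsA b) a ⊗ₖ 1)).trace = ((1 / 2 : ℝ) : ℂ) := by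
    rw [trace_werner_mul_kronecker, transpose_one, mul_one, trace_outcomeProj (trace_obsA b),
      trace_one, Fintype.card_fin]
    push_cast
    ring
  rw [QuantumStrategy.doA, strategy, h, Complex.ofReal_re]

theorem strategy_doC (v : ℝ) (c b : Fin 2) : (strategy v).doC c b = 1 / 2 := by
  have h : ((strategy v).ψBC * (1 ⊗ₖ ketbra c)).trace = ((1 / 2 : ℝ) : ℂ) := by
    rw [← sum_ketbra, Fin.sum_univ_two, add_kronecker, mul_add, trace_add,
      trace_strategy_ψBC_mul_kronecker, trace_strategy_ψBC_mul_kronecker]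
    fin_cases c <;> simp
  exact (congrArg Complex.re h).trans (Complex.ofReal_re _)

end Quantum

section Expectation

/-- The expectation of `(-1) ^ X` for a bit `X` with distribution `p`. -/
def bias (p : Fin 2 → ℝ) : ℝ := p 0 - p 1

theorem abs_bias_le_one {p : Fin 2 → ℝ} (hp : p ∈ stdSimplex ℝ (Fin 2)) : |bias p| ≤ 1 := by
  obtain ⟨h0, h1⟩ := hp
  rw [Fin.sum_univ_two] at h1
  rw [bias, abs_le]
  constructor <;> linarith [h0 0, h0 1]

/-- The expectation of `f A B C` given `B# = s`. -/
def SwigTable.expect (Q : SwigTable) (s : Fin 2) (f : Fin 2 → Fin 2 → Fin 2 → ℝ) : ℝ :=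
  ∑ a, ∑ b, ∑ c, f a b c * Q a b c s

theorem integral_sum_sum_sum {X ι κ τ : Type*} [MeasurableSpace X] {μ : Measure X} [Fintype ι]
    [Fintype κ] [Fintype τ] {f : ι → κ → τ → X → ℝ} (hf : ∀ i j k, Integrable (f i j k) μ) :
    ∫ x, ∑ i, ∑ j, ∑ k, f i j k x ∂μ = ∑ i, ∑ j, ∑ k, ∫ x, f i j k x ∂μ := by
  rw [integral_finsetSum _ fun i _ => integrable_finsetSum _ fun j _ =>
    integrable_finsetSum _ fun k _ => hf i j k]
  refine Finset.sum_congr rfl fun i _ => ?_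
  rw [integral_finsetSum _ fun j _ => integrable_finsetSum _ fun k _ => hf i j k]
  exact Finset.sum_congr rfl fun j _ => integral_finsetSum _ fun k _ => hf i j k

end Expectation

namespace ClassicalModel

section Marginals

variable {Γ : Type u} {Λ : Type w} [MeasurableSpace Γ] [MeasurableSpace Λ]
  (M : ClassicalModel Γ Λ)

theorem pA_mem_stdSimplex (s : Fin 2) (γ : Γ) : M.pA s γ ∈ stdSimplex ℝ (Fin 2) :=
  ⟨M.pA_nonneg s γ, M.pA_sum s γ⟩

theorem pB_mem_stdSimplex (γ : Γ) (α : Λ) : M.pB γ α ∈ stdSimplex ℝ (Fin 2) :=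
  ⟨M.pB_nonneg γ α, M.pB_sum γ α⟩

theorem pC_mem_stdSimplex (s : Fin 2) (α : Λ) : M.pC s α ∈ stdSimplex ℝ (Fin 2) :=
  ⟨M.pC_nonneg s α, M.pC_sum s α⟩

theorem integrable_pA (s a : Fin 2) : Integrable (fun γ => M.pA s γ a) (M.μ : Measure Γ) :=
  .of_mem_Icc 0 1 (M.measurable_pA s a).aemeasurable <| .of_forall fun γ =>
    mem_Icc_of_mem_stdSimplex (M.pA_mem_stdSimplex s γ) a

theorem integrable_pC (s c : Fin 2) : Integrable (fun α => M.pC s α c) (M.ν : Measure Λ) :=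
  .of_mem_Icc 0 1 (M.measurable_pC s c).aemeasurable <| .of_forall fun α =>
    mem_Icc_of_mem_stdSimplex (M.pC_mem_stdSimplex s α) c

/-- The joint response of `A`, `B`, `C` on the interrupted graph to the latent values `x`. -/
def response (a b c s : Fin 2) (x : Γ × Λ) : ℝ := M.pA s x.1 a * M.pB x.1 x.2 b * M.pC s x.2 c

theorem response_mem_Icc (a b c s : Fin 2) (x : Γ × Λ) : M.response a b c s x ∈ Set.Icc 0 1 :=
  unitInterval.mul_mem (unitInterval.mul_mem
    (mem_Icc_of_mem_stdSimplex (M.pA_mem_stdSimplex s x.1) a)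
    (mem_Icc_of_mem_stdSimplex (M.pB_mem_stdSimplex x.1 x.2) b))
    (mem_Icc_of_mem_stdSimplex (M.pC_mem_stdSimplex s x.2) c)

theorem integrable_response (a b c s : Fin 2) :
    Integrable (M.response a b c s) ((M.μ : Measure Γ).prod (M.ν : Measure Λ)) :=
  .of_mem_Icc 0 1 ((((M.measurable_pA s a).comp measurable_fst).mul (M.measurable_pB b)).mul
    ((M.measurable_pC s c).comp measurable_snd)).aemeasurable <|
    .of_forall (M.response_mem_Icc a b c s)

theorem swig_eq_integral_response (a b c s : Fin 2) :
    M.swig a b c s = ∫ x, M.response a b c s x ∂(M.μ : Measure Γ).prod (M.ν : Measure Λ) :=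
  (integral_prod _ (M.integrable_response a b c s)).symm

theorem integrable_sum_mul_response (s : Fin 2) (f : Fin 2 → Fin 2 → Fin 2 → ℝ) :
    Integrable (fun x => ∑ a, ∑ b, ∑ c, f a b c * M.response a b c s x)
      ((M.μ : Measure Γ).prod (M.ν : Measure Λ)) :=
  integrable_finsetSum _ fun a _ => integrable_finsetSum _ fun b _ =>
    integrable_finsetSum _ fun c _ => (M.integrable_response a b c s).const_mul _

theorem swig_expect (s : Fin 2) (f : Fin 2 → Fin 2 → Fin 2 → ℝ) :
    M.swig.expect s f = ∫ x, ∑ a, ∑ b, ∑ c, f a b c * M.response a b c s x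
      ∂(M.μ : Measure Γ).prod (M.ν : Measure Λ) := by
  rw [integral_sum_sum_sum fun a b c => (M.integrable_response a b c s).const_mul _]
  simp only [SwigTable.expect, swig_eq_integral_response, integral_const_mul]

theorem swig_doAC (a c s : Fin 2) : M.swig.doAC a c s =
    (∫ γ, M.pA s γ a ∂(M.μ : Measure Γ)) * ∫ α, M.pC s α c ∂(M.ν : Measure Λ) := by
  simp only [SwigTable.doAC, swig_eq_integral_response]
  rw [← integral_finsetSum _ fun b _ => M.integrable_response a b c s, ← integral_prod_mul]
  simp only [response, ← Finset.sum_mul, ← Finset.mul_sum, M.pB_sum, mul_one]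

theorem sum_integral_pA (s : Fin 2) : ∑ a, ∫ γ, M.pA s γ a ∂(M.μ : Measure Γ) = 1 := by
  rw [← integral_finsetSum _ fun a _ => M.integrable_pA s a]
  simp [M.pA_sum]

theorem sum_integral_pC (s : Fin 2) : ∑ c, ∫ α, M.pC s α c ∂(M.ν : Measure Λ) = 1 := by
  rw [← integral_finsetSum _ fun c _ => M.integrable_pC s c]
  simp [M.pC_sum]

theorem swig_doA (a s : Fin 2) : M.swig.doA a s = ∫ γ, M.pA s γ a ∂(M.μ : Measure Γ) := by
  calc M.swig.doA a s = ∑ c, M.swig.doAC a c s := Finset.sum_comm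
    _ = _ := by simp only [swig_doAC, ← Finset.mul_sum, sum_integral_pC, mul_one]

theorem swig_doC (c s : Fin 2) : M.swig.doC c s = ∫ α, M.pC s α c ∂(M.ν : Measure Λ) := by
  calc M.swig.doC c s = ∑ a, M.swig.doAC a c s := rfl
    _ = _ := by simp only [swig_doAC, ← Finset.sum_mul, sum_integral_pA, one_mul]

theorem swig_doAC_eq_mul (a c s : Fin 2) :
    M.swig.doAC a c s = M.swig.doA a s * M.swig.doC c s := by
  rw [swig_doAC, swig_doA, swig_doC]

theorem swig_isCondDist : M.swig.IsCondDist := by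
  refine ⟨fun a b c s => ?_, fun s => ?_⟩
  · rw [swig_eq_integral_response]
    exact integral_nonneg fun x => (M.response_mem_Icc a b c s x).1
  · calc ∑ a, ∑ b, ∑ c, M.swig a b c s = ∑ a, ∫ γ, M.pA s γ a ∂(M.μ : Measure Γ) :=
          Finset.sum_congr rfl fun a _ => M.swig_doA a s
      _ = 1 := M.sum_integral_pA s

end Marginals

end ClassicalModel

section FusionBell

theorem mul_add_mul_le {b x y c : ℝ} (hb : |b| ≤ 1) (hx : |x| ≤ 1) (hy : |y| ≤ 1) (hc : |c| ≤ 1) :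
    b * (x + y * c) ≤ 1 + (|x + y| - |x - y|) / 2 * c := by
  have hmul (t : ℝ) : b * t ≤ |t| :=
    (le_abs_self _).trans (abs_mul b t ▸ mul_le_of_le_one_left (abs_nonneg t) hb)
  rw [abs_le] at hx hy hc
  have hsum : |x + y| + |x - y| ≤ 2 := by
    rcases abs_cases (x + y) with h | h <;> rcases abs_cases (x - y) with h' | h' <;>
      linarith [h.1, h'.1]
  have hplus := mul_le_mul_of_nonneg_left (hmul (x + y)) (by linarith : 0 ≤ (1 + c) / 2)
  have hminus := mul_le_mul_of_nonneg_left (hmul (x - y)) (by linarith : 0 ≤ (1 - c) / 2)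
  linarith

namespace ClassicalModel

variable {Γ : Type u} {Λ : Type w} [MeasurableSpace Γ] [MeasurableSpace Λ]
  (M : ClassicalModel Γ Λ)

theorem sum_sign_mul_response (s : Fin 2) (x : Γ × Λ) :
    ∑ a : Fin 2, ∑ b : Fin 2, ∑ c, (-1) ^ ((a : ℕ) + (b : ℕ)) * M.response a b c s x =
      bias (M.pA s x.1) * bias (M.pB x.1 x.2) := by
  have hC := M.pC_sum s x.2
  simp only [Fin.sum_univ_two, response, bias, Fin.val_zero, Fin.val_one] at hC ⊢
  linear_combination (M.pA s x.1 0 - M.pA s x.1 1) * (M.pB x.1 x.2 0 - M.pB x.1 x.2 1) * hC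

theorem sum_sign_mul_sign_mul_response (s : Fin 2) (x : Γ × Λ) :
    ∑ a : Fin 2, ∑ b : Fin 2, ∑ c : Fin 2,
        (-1) ^ ((a : ℕ) + (b : ℕ) + (c : ℕ)) * M.response a b c s x =
      bias (M.pA s x.1) * bias (M.pB x.1 x.2) * bias (M.pC s x.2) := by
  simp only [Fin.sum_univ_two, response, bias, Fin.val_zero, Fin.val_one]
  ring

-- An unbiased `C` is an unbiased random setting, known to `B` but independent of `γ`.
theorem expect_sign_add_expect_sign_le_one (hC : M.swig.doC 0 1 = M.swig.doC 1 1) :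
    M.swig.expect 0 (fun a b _ => (-1) ^ ((a : ℕ) + (b : ℕ))) +
      M.swig.expect 1 (fun a b c => (-1) ^ ((a : ℕ) + (b : ℕ) + (c : ℕ))) ≤ 1 := by
  let x (s : Fin 2) (γ : Γ) : ℝ := bias (M.pA s γ)
  let y (α : Λ) : ℝ := bias (M.pC 1 α)
  let g (γ : Γ) : ℝ := (|x 0 γ + x 1 γ| - |x 0 γ - x 1 γ|) / 2
  have hx (s : Fin 2) : Integrable (x s) (M.μ : Measure Γ) :=
    (M.integrable_pA s 0).sub (M.integrable_pA s 1)
  have hg : Integrable g (M.μ : Measure Γ) :=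
    (((hx 0).add (hx 1)).abs.sub ((hx 0).sub (hx 1)).abs).div_const 2
  have hy : Integrable y (M.ν : Measure Λ) := (M.integrable_pC 1 0).sub (M.integrable_pC 1 1)
  have hgy := (integrable_const 1).add (hg.mul_prod hy)
  have hmean : ∫ α, y α ∂(M.ν : Measure Λ) = 0 := by
    simp only [y, bias]
    rw [integral_sub (M.integrable_pC 1 0) (M.integrable_pC 1 1), ← swig_doC, ← swig_doC, hC,
      sub_self]
  rw [swig_expect, swig_expect, ← integral_add (M.integrable_sum_mul_response _ _)
    (M.integrable_sum_mul_response _ _)]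
  calc _ ≤ ∫ z, (1 + g z.1 * y z.2) ∂(M.μ : Measure Γ).prod (M.ν : Measure Λ) := by
        refine integral_mono ((M.integrable_sum_mul_response _ _).add
          (M.integrable_sum_mul_response _ _)) hgy fun z => ?_
        have h := mul_add_mul_le (abs_bias_le_one (M.pB_mem_stdSimplex z.1 z.2))
          (abs_bias_le_one (M.pA_mem_stdSimplex 0 z.1))
          (abs_bias_le_one (M.pA_mem_stdSimplex 1 z.1))
          (abs_bias_le_one (M.pC_mem_stdSimplex 1 z.2))
        simp only [sum_sign_mul_response, sum_sign_mul_sign_mul_response]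
        exact le_of_eq_of_le (by ring) h
    _ = 1 := by
        rw [integral_add (integrable_const 1) (hg.mul_prod hy), integral_prod_mul, hmean]
        simp

theorem sum_sign_obs_sub_sum_sign_obs_le (hA : M.swig.doA 0 0 = M.swig.doA 1 0)
    (hC : M.swig.doC 0 1 = M.swig.doC 1 1) :
    ∑ a : Fin 2, ∑ c, (-1) ^ (a : ℕ) * M.obs a 0 c -
      ∑ a : Fin 2, ∑ c : Fin 2, (-1) ^ ((a : ℕ) + (c : ℕ)) * M.obs a 1 c ≤ 1 / 2 := by
  have hbell := M.expect_sign_add_expect_sign_le_one hC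
  have hindep : ∑ a : Fin 2, ∑ c : Fin 2, (-1) ^ ((a : ℕ) + (c : ℕ)) * M.swig.doAC a c 1 = 0 := by
    simp only [swig_doAC_eq_mul, Fin.sum_univ_two, hC, Fin.val_zero, Fin.val_one]
    ring
  change ∑ a : Fin 2, ∑ c, (-1) ^ (a : ℕ) * M.swig a 0 c 0 -
    ∑ a : Fin 2, ∑ c : Fin 2, (-1) ^ ((a : ℕ) + (c : ℕ)) * M.swig a 1 c 1 ≤ 1 / 2
  simp only [SwigTable.expect, SwigTable.doA, SwigTable.doAC, Fin.sum_univ_two, Fin.val_zero,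
    Fin.val_one] at hA hbell hindep ⊢
  norm_num at hbell hindep ⊢
  linarith

end ClassicalModel

end FusionBell

section Fusion

/-- The law of a uniform bit. -/
def uniformBit : ProbabilityMeasure (Fin 2) :=
  ⟨(PMF.uniformOfFintype (Fin 2)).toMeasure, inferInstance⟩

theorem integral_uniformBit (f : Fin 2 → ℝ) :
    ∫ x, f x ∂(uniformBit : Measure (Fin 2)) = (f 0 + f 1) / 2 := by
  change ∫ x, f x ∂(PMF.uniformOfFintype (Fin 2)).toMeasure = _
  simp only [PMF.integral_eq_sum, Fin.sum_univ_two, PMF.uniformOfFintype_apply, Fintype.card_fin,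
    smul_eq_mul, Nat.cast_ofNat, ENNReal.toReal_inv, ENNReal.toReal_ofNat]
  ring

/-- The model in which all responses are independent uniform bits. -/
def uniformModel : ClassicalModel (Fin 2) (Fin 2) where
  μ := uniformBit
  ν := uniformBit
  pA _ _ _ := 1 / 2
  pB _ _ _ := 1 / 2
  pC _ _ _ := 1 / 2
  measurable_pA _ _ := measurable_const
  measurable_pB _ := measurable_const
  measurable_pC _ _ := measurable_const
  pA_nonneg _ _ _ := one_half_pos.le
  pB_nonneg _ _ _ := one_half_pos.le
  pC_nonneg _ _ _ := one_half_pos.le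
  pA_sum _ _ := by norm_num
  pB_sum _ _ := by norm_num
  pC_sum _ _ := by norm_num

theorem uniformModel_doA (a s : Fin 2) : uniformModel.swig.doA a s = 1 / 2 := by
  simp [ClassicalModel.swig_doA, uniformModel]

theorem uniformModel_doC (c s : Fin 2) : uniformModel.swig.doC c s = 1 / 2 := by
  simp [ClassicalModel.swig_doC, uniformModel]

theorem one_add_mul_neg_one_pow_nonneg {t : ℝ} (ht : |t| ≤ 1) (k : ℕ) : 0 ≤ 1 + t * (-1) ^ k := by
  obtain ⟨hlo, hhi⟩ := abs_le.1 ht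
  rcases neg_one_pow_eq_or ℝ k with h | h <;> rw [h] <;> linarith

/-- A model with uniform bits `γ`, `α`, selected by `B` so as to correlate `A = γ` and `C = α`
given `B = 1`; given `B = 0`, `A` is a biased and `C` an unbiased bit. -/
def selectionModel (t : ℝ) (ht : |t| ≤ 1) : ClassicalModel (Fin 2) (Fin 2) where
  μ := uniformBit
  ν := uniformBit
  pA b γ a := if b = 0 then (1 + t * (-1) ^ (a : ℕ)) / 2 else if a = γ then 1 else 0
  pB γ α b := (1 + t * (-1) ^ ((γ : ℕ) + (α : ℕ) + (b : ℕ))) / 2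
  pC b α c := if b = 0 then 1 / 2 else if c = α then 1 else 0
  measurable_pA _ _ := .of_discrete
  measurable_pB _ := .of_discrete
  measurable_pC _ _ := .of_discrete
  pA_nonneg b γ a := by
    have h := one_add_mul_neg_one_pow_nonneg ht a
    split_ifs <;> positivity
  pB_nonneg γ α b := div_nonneg (one_add_mul_neg_one_pow_nonneg ht _) zero_le_two
  pC_nonneg b α c := by split_ifs <;> norm_num
  pA_sum b γ := by
    split_ifs
    · simp only [Fin.sum_univ_two, Fin.val_zero, Fin.val_one]
      ring
    · simp only [Finset.sum_ite_eq', Finset.mem_univ, if_true]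
  pB_sum γ α := by
    simp only [Fin.sum_univ_two, Fin.val_zero, Fin.val_one]
    ring
  pC_sum b α := by split_ifs <;> simp

theorem selectionModel_obs (t : ℝ) (ht : |t| ≤ 1) (a b c : Fin 2) :
    (selectionModel t ht).obs a b c =
      1 / 8 * (1 + t * (-1) ^ ((a : ℕ) + (b : ℕ) + (c : ℕ) * (b : ℕ))) := by
  simp only [ClassicalModel.obs, selectionModel, integral_uniformBit]
  fin_cases a <;> fin_cases b <;> fin_cases c <;> simp <;> ring

theorem half_lt_div_sqrt_two {v : ℝ} (hv : 1 / √2 < v) : 1 / 2 < v / √2 := by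
  have h2 : (0 : ℝ) < √2 := by positivity
  calc 1 / 2 = 1 / √2 / √2 := by rw [div_div, Real.mul_self_sqrt zero_le_two]
    _ < v / √2 := div_lt_div_of_pos_right hv h2

theorem strategy_sum_sign_obs_sub_sum_sign_obs (v : ℝ) :
    ∑ a : Fin 2, ∑ c, (-1) ^ (a : ℕ) * (strategy v).obs a 0 c -
      ∑ a : Fin 2, ∑ c : Fin 2, (-1) ^ ((a : ℕ) + (c : ℕ)) * (strategy v).obs a 1 c = v / √2 := by
  simp only [strategy_obs, Fin.sum_univ_two, Fin.val_zero, Fin.val_one]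
  ring

theorem strategy_joint_nonclassical {v : ℝ} (hv : 1 / √2 < v) :
    ¬ ∃ Q : SwigTable, SwigTable.IsClassical.{u, w} Q ∧ Q.obs = (strategy v).obs ∧
      Q.doA = (strategy v).doA ∧ Q.doC = (strategy v).doC := by
  rintro ⟨_, ⟨Γ, Λ, _, _, M, rfl⟩, hobs, hA, hC⟩
  change M.obs = _ at hobs
  have hbell := M.sum_sign_obs_sub_sum_sign_obs_le (by simp only [hA, strategy_doA])
    (by simp only [hC, strategy_doC])
  rw [hobs, strategy_sum_sign_obs_sub_sum_sign_obs] at hbell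
  exact (half_lt_div_sqrt_two hv).not_ge hbell

theorem strategy_nonClassicalFusion {v : ℝ} (hv : 1 / √2 < v) (hv1 : v ≤ 1) :
    NonClassicalFusion.{u, w} (strategy v).obs (strategy v).doA (strategy v).doC where
  obs_classical := by
    have h0 : 0 ≤ v / √2 := one_half_pos.le.trans (half_lt_div_sqrt_two hv).le
    have h1 : v / √2 ≤ 1 := div_le_one_of_le₀ (hv1.trans (Real.one_le_sqrt.2 one_le_two)) (by simp)
    refine ⟨2, 2, selectionModel (v / √2) (abs_le.2 ⟨by linarith, h1⟩), ?_⟩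
    ext a b c
    rw [selectionModel_obs, strategy_obs]
  doA_classical := ⟨2, 2, uniformModel, by ext a s; rw [uniformModel_doA, strategy_doA]⟩
  doC_classical := ⟨2, 2, uniformModel, by ext c s; rw [uniformModel_doC, strategy_doC]⟩
  doAC_classical := ⟨2, 2, uniformModel, fun a c s => by
    rw [ClassicalModel.swig_doAC_eq_mul, uniformModel_doA, uniformModel_doC, strategy_doA,
      strategy_doC]⟩
  joint_nonclassical := strategy_joint_nonclassical hv

end Fusion

section ProductDistributions

variable {ι κ X : Type*} [Fintype ι] [Fintype κ] [Fintype X] [DecidableEq ι] [DecidableEq κ]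
  {R : Type*} [CommSemiring R]

theorem sum_ite_forall_prod (P : ι → X → Prop) [∀ i, DecidablePred (P i)] (f : ι → X → R) :
    (∑ F : ι → X, if ∀ i, P i (F i) then ∏ i, f i (F i) else 0) =
      ∏ i, ∑ x, if P i x then f i x else 0 := by
  simp only [Fintype.prod_sum, Fintype.prod_ite_zero]

theorem sum_ite_eq_prod_of_sum_eq_one [DecidableEq X] {p : κ → X → R}
    (hp : ∀ k, ∑ x, p k x = 1) (t : κ) (a : X) :
    (∑ f : κ → X, if f t = a then ∏ k, p k (f k) else 0) = p t a := by
  have hcoord (f : κ → X) : f t = a ↔ ∀ k, k = t → f k = a := by simp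
  simp only [hcoord, sum_ite_forall_prod (fun k x => k = t → x = a)]
  rw [Finset.prod_eq_single t (fun k _ hk => by simp [hk, hp]) (by simp)]
  simp

theorem sum_ite_forall_eq_prod_prod_of_sum_eq_one [DecidableEq X] {p : ι → κ → X → R}
    (hp : ∀ i k, ∑ x, p i k x = 1) (t : ι → κ) (a : ι → X) :
    (∑ F : ι → κ → X, if ∀ i, F i (t i) = a i then ∏ i, ∏ k, p i k (F i k) else 0) =
      ∏ i, p i (t i) (a i) :=
  (sum_ite_forall_prod (fun i (f : κ → X) => f (t i) = a i) fun i f => ∏ k, p i k (f k)).trans <|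
    Finset.prod_congr rfl fun i _ => sum_ite_eq_prod_of_sum_eq_one (hp i) (t i) (a i)

theorem sum_prod_prod_eq_one_of_sum_eq_one {p : ι → κ → X → R} (hp : ∀ i k, ∑ x, p i k x = 1) :
    ∑ F : ι → κ → X, ∏ i, ∏ k, p i k (F i k) = 1 := by
  rw [← Fintype.prod_sum fun i (f : κ → X) => ∏ k, p i k (f k)]
  simp only [← Fintype.prod_sum, hp, Finset.prod_const_one]

theorem sum_sum_sum_mul {α β γ : Type*} [Fintype α] [Fintype β] [Fintype γ] (f : α → R)
    (g : β → R) (h : γ → R) :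
    ∑ a, ∑ b, ∑ c, f a * g b * h c = (∑ a, f a) * (∑ b, g b) * ∑ c, h c := by
  simp only [← Finset.mul_sum, ← Finset.sum_mul]

theorem sum_sum_sum_ite_mul {α β γ : Type*} [Fintype α] [Fintype β] [Fintype γ] (P : α → Prop)
    (Q : β → Prop) (S : γ → Prop) [DecidablePred P] [DecidablePred Q] [DecidablePred S]
    (f : α → R) (g : β → R) (h : γ → R) :
    (∑ a, ∑ b, ∑ c, if P a ∧ Q b ∧ S c then f a * g b * h c else 0) =
      (∑ a, if P a then f a else 0) * (∑ b, if Q b then g b else 0) *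
        ∑ c, if S c then h c else 0 := by
  rw [← sum_sum_sum_mul]
  refine Fintype.sum_congr _ _ fun a => Fintype.sum_congr _ _ fun b =>
    Fintype.sum_congr _ _ fun c => ?_
  by_cases P a <;> by_cases Q b <;> by_cases S c <;> simp [*]

end ProductDistributions

namespace ClassicalModel

section Inflation

variable {Γ : Type u} {Λ : Type w} [MeasurableSpace Γ] [MeasurableSpace Λ]
  (M : ClassicalModel Γ Λ)

/-- The law of independent copies, indexed by `ι`, of both latent variables. -/
abbrev copiesLaw (ι : Type*) [Fintype ι] : Measure ((ι → Γ) × (ι → Λ)) :=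
  (Measure.pi fun _ => (M.μ : Measure Γ)).prod (Measure.pi fun _ => (M.ν : Measure Λ))

variable {ι : Type*} [Fintype ι]

/-- The joint response of the copies `A i s`, `B i j`, `C j s` of the observed nodes to copies
`z.1 i`, `z.2 j` of the latent variables. -/
def inflationResponse (A : ι → Fin 2 → Fin 2) (B : ι → ι → Fin 2) (C : ι → Fin 2 → Fin 2)
    (z : (ι → Γ) × (ι → Λ)) : ℝ :=
  (∏ i, ∏ s, M.pA s (z.1 i) (A i s)) * (∏ i, ∏ j, M.pB (z.1 i) (z.2 j) (B i j)) *
    ∏ j, ∏ s, M.pC s (z.2 j) (C j s)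

/-- The inflation of the model with independent copies, indexed by `ι`, of both sources. -/
def inflation (A : ι → Fin 2 → Fin 2) (B : ι → ι → Fin 2) (C : ι → Fin 2 → Fin 2) : ℝ :=
  ∫ z, M.inflationResponse A B C z ∂M.copiesLaw ι

variable (A : ι → Fin 2 → Fin 2) (B : ι → ι → Fin 2) (C : ι → Fin 2 → Fin 2)

theorem inflationResponse_mem_Icc (z : (ι → Γ) × (ι → Λ)) :
    M.inflationResponse A B C z ∈ Set.Icc 0 1 := by
  refine unitInterval.mul_mem (unitInterval.mul_mem ?_ ?_) ?_ <;>
    refine unitInterval.prod_mem fun i _ => unitInterval.prod_mem fun k _ => ?_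
  exacts [mem_Icc_of_mem_stdSimplex (M.pA_mem_stdSimplex _ _) _,
    mem_Icc_of_mem_stdSimplex (M.pB_mem_stdSimplex _ _) _,
    mem_Icc_of_mem_stdSimplex (M.pC_mem_stdSimplex _ _) _]

theorem measurable_inflationResponse : Measurable (M.inflationResponse A B C) := by
  refine .mul (.mul ?_ ?_) ?_ <;>
    refine Finset.measurable_fun_prod _ fun i _ => Finset.measurable_fun_prod _ fun k _ => ?_
  · exact (M.measurable_pA k (A i k)).comp ((measurable_pi_apply i).comp measurable_fst)
  · exact (M.measurable_pB (B i k)).comp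
      (f := fun z : (ι → Γ) × (ι → Λ) => (z.1 i, z.2 k)) (by fun_prop)
  · exact (M.measurable_pC k (C i k)).comp ((measurable_pi_apply i).comp measurable_snd)

theorem integrable_inflationResponse : Integrable (M.inflationResponse A B C) (M.copiesLaw ι) :=
  .of_mem_Icc 0 1 (M.measurable_inflationResponse A B C).aemeasurable <|
    .of_forall (M.inflationResponse_mem_Icc A B C)

theorem inflation_nonneg : 0 ≤ M.inflation A B C :=
  integral_nonneg fun z => (M.inflationResponse_mem_Icc A B C z).1

theorem inflation_comp_perm (σ τ : Equiv.Perm ι) :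
    M.inflation (fun i => A (σ i)) (fun i j => B (σ i) (τ j)) (fun j => C (τ j)) =
      M.inflation A B C := by
  let e := (MeasurableEquiv.arrowCongr' σ (.refl Γ)).prodCongr
    (MeasurableEquiv.arrowCongr' τ (.refl Λ))
  have he : MeasurePreserving e (M.copiesLaw ι) (M.copiesLaw ι) :=
    (measurePreserving_arrowCongr' (fun _ => (M.μ : Measure Γ)) (fun _ => (M.μ : Measure Γ)) σ
      (.refl Γ) fun _ => .id _).prod
    (measurePreserving_arrowCongr' (fun _ => (M.ν : Measure Λ)) (fun _ => (M.ν : Measure Λ)) τ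
      (.refl Λ) fun _ => .id _)
  have hresp (z : (ι → Γ) × (ι → Λ)) : M.inflationResponse A B C (e z) =
      M.inflationResponse (fun i => A (σ i)) (fun i j => B (σ i) (τ j)) (fun j => C (τ j)) z := by
    have h1 (i : ι) : (e z).1 (σ i) = z.1 i := congrArg z.1 (σ.symm_apply_apply i)
    have h2 (j : ι) : (e z).2 (τ j) = z.2 j := congrArg z.2 (τ.symm_apply_apply j)
    simp only [inflationResponse, ← h1, ← h2]
    rw [Equiv.prod_comp σ fun i => ∏ s, M.pA s ((e z).1 i) (A i s),
      Equiv.prod_comp σ fun i => ∏ j, M.pB ((e z).1 i) ((e z).2 (τ j)) (B i (τ j)),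
      Equiv.prod_comp τ fun j => ∏ s, M.pC s ((e z).2 j) (C j s)]
    simp only [fun i => Equiv.prod_comp τ fun j => M.pB ((e z).1 i) ((e z).2 j) (B i j)]
  rw [inflation, inflation, ← he.integral_comp' (M.inflationResponse A B C)]
  simp only [hresp]

variable [DecidableEq ι]

theorem sum_inflationResponse (z : (ι → Γ) × (ι → Λ)) :
    ∑ A, ∑ B, ∑ C, M.inflationResponse A B C z = 1 := by
  simp only [inflationResponse, sum_sum_sum_mul]
  rw [sum_prod_prod_eq_one_of_sum_eq_one fun i s => M.pA_sum s (z.1 i),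
    sum_prod_prod_eq_one_of_sum_eq_one fun i j => M.pB_sum (z.1 i) (z.2 j),
    sum_prod_prod_eq_one_of_sum_eq_one fun j s => M.pC_sum s (z.2 j), one_mul, one_mul]

theorem sum_inflation :
    ∑ A : ι → Fin 2 → Fin 2, ∑ B : ι → ι → Fin 2, ∑ C : ι → Fin 2 → Fin 2,
      M.inflation A B C = 1 := by
  simp only [inflation]
  rw [← integral_sum_sum_sum fun A B C => M.integrable_inflationResponse A B C]
  simp [sum_inflationResponse]

theorem sum_ite_inflationResponse (s a b c : ι → Fin 2) (z : (ι → Γ) × (ι → Λ)) :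
    (∑ A, ∑ B, ∑ C,
      if (∀ i, A i (s i) = a i) ∧ (∀ i, B i i = b i) ∧ ∀ i, C i (s i) = c i
      then M.inflationResponse A B C z else 0) =
      ∏ i, M.response (a i) (b i) (c i) (s i) (z.1 i, z.2 i) := by
  simp only [inflationResponse]
  rw [sum_sum_sum_ite_mul (fun A : ι → Fin 2 → Fin 2 => ∀ i, A i (s i) = a i)
    (fun B : ι → ι → Fin 2 => ∀ i, B i i = b i) (fun C : ι → Fin 2 → Fin 2 => ∀ i, C i (s i) = c i),
    sum_ite_forall_eq_prod_prod_of_sum_eq_one fun i s => M.pA_sum s (z.1 i),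
    sum_ite_forall_eq_prod_prod_of_sum_eq_one fun i j => M.pB_sum (z.1 i) (z.2 j),
    sum_ite_forall_eq_prod_prod_of_sum_eq_one fun j s => M.pC_sum s (z.2 j),
    ← Finset.prod_mul_distrib, ← Finset.prod_mul_distrib]
  rfl

theorem sum_ite_inflation (s a b c : ι → Fin 2) :
    (∑ A, ∑ B, ∑ C,
      if (∀ i, A i (s i) = a i) ∧ (∀ i, B i i = b i) ∧ ∀ i, C i (s i) = c i
      then M.inflation A B C else 0) = ∏ i, M.swig (a i) (b i) (c i) (s i) := by
  have hcopies := measurePreserving_arrowProdEquivProdArrow Γ Λ ι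
    (fun _ => (M.μ : Measure Γ)) (fun _ => (M.ν : Measure Λ))
  have hint (A : ι → Fin 2 → Fin 2) (B : ι → ι → Fin 2) (C : ι → Fin 2 → Fin 2) :
      Integrable (fun z => if (∀ i, A i (s i) = a i) ∧ (∀ i, B i i = b i) ∧ ∀ i, C i (s i) = c i
        then M.inflationResponse A B C z else 0) (M.copiesLaw ι) := by
    split_ifs
    exacts [M.integrable_inflationResponse A B C, integrable_zero _ _ _]
  calc _ = ∫ z, ∏ i, M.response (a i) (b i) (c i) (s i) (z.1 i, z.2 i) ∂M.copiesLaw ι := by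
        simp only [← sum_ite_inflationResponse]
        rw [integral_sum_sum_sum hint]
        refine Fintype.sum_congr _ _ fun A => Fintype.sum_congr _ _ fun B =>
          Fintype.sum_congr _ _ fun C => ?_
        split_ifs
        exacts [rfl, integral_zero _ _ |>.symm]
    _ = ∏ i, ∫ x, M.response (a i) (b i) (c i) (s i) x
          ∂(M.μ : Measure Γ).prod (M.ν : Measure Λ) := by
        rw [← hcopies.integral_comp', ← integral_fintype_prod_eq_prod]
        rfl
    _ = ∏ i, M.swig (a i) (b i) (c i) (s i) := by simp only [swig_eq_integral_response]

theorem hasSecondOrderInflation : M.swig.HasSecondOrderInflation := by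
  refine ⟨M.inflation, M.inflation_nonneg, M.sum_inflation, fun A B C => ?_, fun A B C => ?_,
    fun s₀ s₁ a₀ a₁ b₀ b₁ c₀ c₁ => ?_⟩
  · exact M.inflation_comp_perm A B C (Equiv.subLeft 1) 1
  · exact M.inflation_comp_perm A B C 1 (Equiv.subLeft 1)
  · have h := M.sum_ite_inflation ![s₀, s₁] ![a₀, a₁] ![b₀, b₁] ![c₀, c₁]
    simpa [Fin.forall_fin_two, and_assoc] using h

end Inflation

end ClassicalModel

section Polarization

theorem bilin_apply_eq_sum_of_repr_mul_repr {V ι Z : Type*} [AddCommGroup V] [Module ℝ V]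
    [Finite ι] [Fintype Z] (b : Module.Basis ι ℝ V) (F : V →ₗ[ℝ] V →ₗ[ℝ] ℝ) {x y : V} {w : Z → ℝ}
    {u v : Z → V}
    (h : ∀ i j, b.repr x i * b.repr y j = ∑ z, w z * (b.repr (u z) i * b.repr (v z) j)) :
    F x y = ∑ z, w z * F (u z) (v z) := by
  have := Fintype.ofFinite ι
  have hexpand (x y : V) : F x y = ∑ i, ∑ j, b.repr x i * b.repr y j * F (b i) (b j) := by
    rw [← LinearMap.sum_repr_mul_repr_mul b b, Finsupp.sum_fintype _ _ (by simp)]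
    refine Fintype.sum_congr _ _ fun i => ?_
    rw [Finsupp.sum_fintype _ _ (by simp)]
    simp only [smul_eq_mul, mul_assoc]
  calc F x y = ∑ i, ∑ j, ∑ z, w z * (b.repr (u z) i * b.repr (v z) j * F (b i) (b j)) := by
        simp only [hexpand x y, h, Finset.sum_mul, mul_assoc]
    _ = ∑ i, ∑ z, ∑ j, w z * (b.repr (u z) i * b.repr (v z) j * F (b i) (b j)) :=
        Fintype.sum_congr _ _ fun _ => Finset.sum_comm
    _ = ∑ z, ∑ i, ∑ j, w z * (b.repr (u z) i * b.repr (v z) j * F (b i) (b j)) :=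
        Finset.sum_comm
    _ = ∑ z, w z * F (u z) (v z) := by simp only [hexpand (u _), Finset.mul_sum]

/-- The basis of the space of tables formed by the tables with one nonzero entry, equal to `1`. -/
def swigTableBasis : Module.Basis (Σ _ : Fin 2, Σ _ : Fin 2, Σ _ : Fin 2, Fin 2) ℝ SwigTable :=
  Pi.basis fun _ => Pi.basis fun _ => Pi.basis fun _ => Pi.basisFun ℝ (Fin 2)

theorem swigTableBasis_repr (Q : SwigTable) (a b c s : Fin 2) :
    swigTableBasis.repr Q ⟨a, b, c, s⟩ = Q a b c s := by
  simp [swigTableBasis, Pi.basis_repr]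

/-- The polarization of the witness: on the diagonal and for normalized tables it is
`UC.witness`, whose linear part is made quadratic by the total mass of the first table. -/
def polarWitness (Q R : SwigTable) : ℝ :=
  Q.doA 0 0 * R.doA 0 0 - Q.doA 0 0 * witnessI R.obs
    + (2 * margAB Q.obs 0 1 * margBC R.obs 1 0 + margAB Q.obs 0 0 * margAB R.obs 1 0
      - Q.obs 0 1 0 * R.obs 0 1 0
      + (margAB Q.obs 1 0 + margB Q.obs 0) * (margBC R.obs 1 0 + R.obs 0 1 1))
    + (∑ a, ∑ b, ∑ c, Q a b c 0) * witnessJ R.obs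

theorem witness_eq_polarWitness {Q : SwigTable} (hQ : ∑ a, ∑ b, ∑ c, Q a b c 0 = 1) :
    witness Q.obs Q.doA = polarWitness Q Q := by
  rw [polarWitness, hQ, witness, witnessE]
  ring

/-- `UC.polarWitness` as a bilinear form. -/
def polarWitnessForm : SwigTable →ₗ[ℝ] SwigTable →ₗ[ℝ] ℝ := by
  refine LinearMap.mk₂ ℝ polarWitness ?_ ?_ ?_ ?_ <;> intros <;>
    simp only [polarWitness, witnessI, witnessJ, margAB, margBC, margB, SwigTable.obs,
      SwigTable.doA, Pi.add_apply, Pi.smul_apply, smul_eq_mul, Finset.sum_add_distrib,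
      ← Finset.mul_sum] <;> ring

theorem polarWitness_eq_sum {Z : Type*} [Fintype Z] {Q R : SwigTable} {w : Z → ℝ}
    {δ ε : Z → SwigTable}
    (h : ∀ a b c s a' b' c' s', Q a b c s * R a' b' c' s' =
      ∑ z, w z * (δ z a b c s * ε z a' b' c' s')) :
    polarWitness Q R = ∑ z, w z * polarWitness (δ z) (ε z) :=
  bilin_apply_eq_sum_of_repr_mul_repr swigTableBasis polarWitnessForm
    fun ⟨a, b, c, s⟩ ⟨a', b', c', s'⟩ => by
      simpa only [swigTableBasis_repr] using h a b c s a' b' c' s'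

/-- The table of independent responses in which `A = 1`, `B = 1`, `C = 1` have the probabilities
`x s`, `t`, `y s` at `B# = s`; it is deterministic if these are all `0` or `1`. -/
def productTable (x : Fin 2 → ℝ) (t : ℝ) (y : Fin 2 → ℝ) : SwigTable := fun a b c s =>
  ![1 - x s, x s] a * ![1 - t, t] b * ![1 - y s, y s] c

theorem polarWitness_productTable_add (x x' y y' : Fin 2 → ℝ) (t t' : ℝ) :
    polarWitness (productTable x t y) (productTable x' t' y') +
        polarWitness (productTable x' t' y') (productTable x t y) =
      -4 * (1 - t) * (1 - t') * x 0 * x' 0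
        - 2 * (1 - t) * t' * x 0 * ((1 - x' 1) * (1 - y' 1) + x' 1 * y' 1)
        - 2 * t * (1 - t') * x' 0 * ((1 - x 1) * (1 - y 1) + x 1 * y 1)
        + t * t' * (2 * (x 1 - x' 1) * (y' 1 - y 1) + 2 * (1 - x 0) * (1 - x' 0)
          - (1 - x 0) * (2 * x' 1 + 2 * y' 1 - 3 * x' 1 * y' 1)
          - (1 - x' 0) * (2 * x 1 + 2 * y 1 - 3 * x 1 * y 1)
          - 2 * (1 - x 1) * (1 - y 1) * (1 - x' 1) * (1 - y' 1)) := by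
  simp only [polarWitness, witnessI, witnessJ, margAB, margBC, margB, SwigTable.obs,
    SwigTable.doA, productTable, Fin.sum_univ_two, Matrix.cons_val_zero, Matrix.cons_val_one]
  ring

theorem polarWitness_productTable_add_le {x x' y y' : Fin 2 → ℝ} {t t' : ℝ}
    (hx : ∀ s, x s = 0 ∨ x s = 1) (hx' : ∀ s, x' s = 0 ∨ x' s = 1) (ht : t = 0 ∨ t = 1)
    (ht' : t' = 0 ∨ t' = 1) (hy : y 1 = 0 ∨ y 1 = 1) (hy' : y' 1 = 0 ∨ y' 1 = 1) :
    polarWitness (productTable x t y) (productTable x' t' y') +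
        polarWitness (productTable x' t' y') (productTable x t y) ≤
      2 * (x 0 * x' 0 * (x 1 - x' 1) * (y' 1 - y 1)) := by
  rw [polarWitness_productTable_add]
  rcases ht with rfl | rfl <;> rcases ht' with rfl | rfl <;>
  rcases hx 0 with h0 | h0 <;> rcases hx' 0 with h0' | h0' <;> rw [h0, h0'] <;>
  rcases hx 1 with h1 | h1 <;> rcases hx' 1 with h1' | h1' <;>
  rcases hy with h2 | h2 <;> rcases hy' with h2' | h2' <;> rw [h1, h1', h2, h2'] <;> norm_num

theorem productTable_natCast (A C : Fin 2 → Fin 2) (B a b c s : Fin 2) :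
    productTable (fun s => (A s : ℕ)) (B : ℕ) (fun s => (C s : ℕ)) a b c s =
      if A s = a ∧ B = b ∧ C s = c then 1 else 0 := by
  have hbit (k l : Fin 2) : ![1 - ((k : ℕ) : ℝ), (k : ℕ)] l = if k = l then 1 else 0 := by
    fin_cases k <;> fin_cases l <;> simp
  simp only [productTable, hbit, ite_and, ite_mul, one_mul, zero_mul]

end Polarization

section InflationBound

/-- The values of the bits `A i s`, `B i j`, `C j s` of a second-order inflation. -/
abbrev InflationBits :=
  (Fin 2 → Fin 2 → Fin 2) × (Fin 2 → Fin 2 → Fin 2) × (Fin 2 → Fin 2 → Fin 2)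

/-- The deterministic table of the `i`-th diagonal copy. -/
def InflationBits.table (z : InflationBits) (i : Fin 2) : SwigTable :=
  productTable (fun s => (z.1 i s : ℕ)) (z.2.1 i i : ℕ) fun s => (z.2.2 i s : ℕ)

/-- Exchange of the two copies of the source `α`. -/
def InflationBits.swapα (z : InflationBits) : InflationBits :=
  (z.1, fun i j => z.2.1 i (1 - j), fun j => z.2.2 (1 - j))

theorem InflationBits.swapα_involutive : Function.Involutive swapα := fun z => by
  simp [swapα]

/-- The bound on the symmetrized witness, antisymmetric under exchange of the copies of `α`. -/
def InflationBits.swapDefect (z : InflationBits) : ℝ :=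
  (z.1 0 0 : ℕ) * (z.1 1 0 : ℕ) * ((z.1 0 1 : ℕ) - (z.1 1 1 : ℕ)) *
    ((z.2.2 1 1 : ℕ) - (z.2.2 0 1 : ℕ))

theorem InflationBits.swapDefect_swapα (z : InflationBits) :
    z.swapα.swapDefect = -z.swapDefect := by
  simp only [swapDefect, swapα, sub_self, sub_zero]
  ring

theorem InflationBits.sum_mul_swapDefect_eq_zero {w : InflationBits → ℝ}
    (hw : ∀ z, w z.swapα = w z) : ∑ z, w z * z.swapDefect = 0 := by
  have hsum := swapα_involutive.toPerm.sum_comp Finset.univ (fun z => w z * z.swapDefect) (by simp)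
  simp only [Function.Involutive.coe_toPerm, hw, swapDefect_swapα, mul_neg,
    Finset.sum_neg_distrib] at hsum
  linarith

theorem InflationBits.polarWitness_table_add_le (z : InflationBits) :
    polarWitness (z.table 0) (z.table 1) + polarWitness (z.table 1) (z.table 0) ≤
      2 * z.swapDefect := by
  have hbit (k : Fin 2) : ((k : ℕ) : ℝ) = 0 ∨ ((k : ℕ) : ℝ) = 1 := by fin_cases k <;> simp
  exact polarWitness_productTable_add_le (fun _ => hbit _) (fun _ => hbit _) (hbit _) (hbit _)
    (hbit _) (hbit _)

theorem polarWitness_self_nonpos {Q : SwigTable} (h : Q.HasSecondOrderInflation) :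
    polarWitness Q Q ≤ 0 := by
  obtain ⟨q, hq, -, -, hswap, hdiag⟩ := h
  let w (z : InflationBits) : ℝ := q z.1 z.2.1 z.2.2
  have hprod (a b c s a' b' c' s' : Fin 2) : Q a b c s * Q a' b' c' s' =
      ∑ z, w z * (z.table 0 a b c s * z.table 1 a' b' c' s') := by
    simp only [← hdiag, Fintype.sum_prod_type, InflationBits.table, productTable_natCast]
    refine Fintype.sum_congr _ _ fun A => Fintype.sum_congr _ _ fun B =>
      Fintype.sum_congr _ _ fun C => ?_
    simp only [mul_ite, mul_one, mul_zero, ← ite_and]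
    exact if_congr (by tauto) rfl rfl
  have h01 : polarWitness Q Q = ∑ z, w z * polarWitness (z.table 0) (z.table 1) :=
    polarWitness_eq_sum hprod
  have h10 : polarWitness Q Q = ∑ z, w z * polarWitness (z.table 1) (z.table 0) :=
    polarWitness_eq_sum fun a b c s a' b' c' s' => by
      rw [mul_comm, hprod]
      simp only [mul_comm]
  have hdefect : ∑ z, w z * z.swapDefect = 0 :=
    InflationBits.sum_mul_swapDefect_eq_zero fun z => hswap z.1 z.2.1 z.2.2
  have hle : polarWitness Q Q + polarWitness Q Q ≤ 0 := by
    calc polarWitness Q Q + polarWitness Q Q = ∑ z, w z *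
          (polarWitness (z.table 0) (z.table 1) + polarWitness (z.table 1) (z.table 0)) := by
          simp only [mul_add, Finset.sum_add_distrib, ← h01, ← h10]
      _ ≤ ∑ z, w z * (2 * z.swapDefect) := Finset.sum_le_sum fun z _ =>
          mul_le_mul_of_nonneg_left z.polarWitness_table_add_le (hq _ _ _)
      _ = 0 := by simp only [mul_left_comm _ (2 : ℝ), ← Finset.mul_sum, hdefect, mul_zero]
  linarith

theorem witness_nonpos_of_hasSecondOrderInflation {Q : SwigTable} (hQ : Q.IsCondDist)
    (h : Q.HasSecondOrderInflation) : witness Q.obs Q.doA ≤ 0 :=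
  (witness_eq_polarWitness (hQ.2 0)).trans_le (polarWitness_self_nonpos h)

end InflationBound

section Violation

theorem witness_strategy_one :
    witness (strategy 1).obs (strategy 1).doA = (38 * √2 - 53) / 128 := by
  have h2 : √2 * √2 = 2 := Real.mul_self_sqrt zero_le_two
  have hinv : 1 / √2 = √2 / 2 := by
    rw [div_eq_div_iff (by positivity) two_ne_zero, h2, one_mul]
  simp only [witness, witnessI, witnessE, witnessJ, margAB, margB, margBC, strategy_obs,
    strategy_doA, Fin.sum_univ_two, hinv, Fin.val_zero, Fin.val_one]
  linear_combination -7 / 256 * h2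

theorem witness_violation_pos : 0 < (38 * √2 - 53) / 128 := by
  have h : 1.4 < √2 := Real.lt_sqrt_of_sq_lt (by norm_num)
  linarith

end Violation

end UC

end

theorem theorem1 :
    -- the strategy is a quantum strategy and produces the stated tables
    (∀ v : ℝ, 0 ≤ v → v ≤ 1 →
      (UC.strategy v).IsValid ∧
      (∀ a b c : Fin 2, (UC.strategy v).obs a b c =
        1 / 8 * (1 + v / √2 * (-1) ^ ((a : ℕ) + (b : ℕ) + (c : ℕ) * (b : ℕ)))) ∧
      (∀ a b : Fin 2, (UC.strategy v).doA a b = 1 / 2) ∧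
      (∀ c b : Fin 2, (UC.strategy v).doC c b = 1 / 2)) ∧
    -- non-classicality from data fusion
    (∀ v : ℝ, 1 / √2 < v → v ≤ 1 →
      UC.NonClassicalFusion.{u, w} (UC.strategy v).obs (UC.strategy v).doA
        (UC.strategy v).doC) ∧
    -- the quadratic inequality holds classically, already for second-order inflations,
    -- and is violated at `v = 1`
    (∀ (Γ : Type u) (Λ : Type w) [MeasurableSpace Γ] [MeasurableSpace Λ]
      (M : UC.ClassicalModel Γ Λ), UC.witness M.obs M.swig.doA ≤ 0) ∧
    (∀ Q : UC.SwigTable, Q.IsCondDist → Q.HasSecondOrderInflation →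
      UC.witness Q.obs Q.doA ≤ 0) ∧
    UC.witness (UC.strategy 1).obs (UC.strategy 1).doA = (38 * √2 - 53) / 128 ∧
    0 < (38 * √2 - 53) / 128 :=
  ⟨fun v h0 h1 => ⟨UC.strategy_isValid h0 h1, UC.strategy_obs v, UC.strategy_doA v,
      UC.strategy_doC v⟩,
    fun _ hv hv1 => UC.strategy_nonClassicalFusion hv hv1,
    fun _ _ _ _ M =>
      UC.witness_nonpos_of_hasSecondOrderInflation M.swig_isCondDist M.hasSecondOrderInflation,
    fun _ hQ h => UC.witness_nonpos_of_hasSecondOrderInflation hQ h,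
    UC.witness_strategy_one, UC.witness_violation_pos⟩
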